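/- All vector spaces and algebras are complex, all Banach spaces are infinite-dimensional, and *operator* means continuous linear map; $\mathcal B(X,Y)$ is the space of operators from $X$ to $Y$ and $\mathcal B(X)=\mathcal B(X,X)$. An *ideal of operators* $\mathcal J$ assigns to each pair of Banach spaces $(X,Y)$ a subspace $\mathcal J(X,Y)\subseteq\mathcal B(X,Y)$ such that $TSR\in\mathcal J(W,Z)$ whenever $R\in\mathcal B(W,X)$, $S\in\mathcal J(X,Y)$ and $T\in\mathcal B(Y,Z)$; put $\mathcal J(X)=\mathcal J(X,X)$. It is *closed* if every $\mathcal J(X,Y)$ is closed in $\mathcal B(X,Y)$, and *non-zero* if $\mathcal J(X,Y)\ne\{0\}$ for all $X,Y$. An operator is *strictly singular* if every subspace on which it is bounded below is finite-dimensional. For a unital algebra $A$, $K_0(A)$ is the Grothendieck group of the commutative semigroup of classes of idempotent square matrices over $A$ of arbitrary size under the relation $P\sim_0Q$ iff $P=RT$ and $Q=TR$ for some rectangular matrices $R,T$ over $A$, with addition induced by the block-diagonal sum. A short exact sequence $0\to A\xrightarrow{\varphi}B\xrightarrow{\psi}C\to0$ of (not necessarily unital) algebras *splits algebraically* if there is an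 algebra homomorphism $\theta:C\to B$ (not assumed unital or continuous) with $\psi\circ\theta=\mathrm{id}_C$. The index of a Fredholm operator $T$ is $\dim\ker T-\operatorname{codim}\operatorname{im}T$. Let $\mathcal J$ be a closed, non-zero ideal of operators consisting of strictly singular operators, let $X$ be an (infinite-dimensional, complex) Banach space, and let $\Sigma_X$ denote the short exact sequence $$\{0\}\to\mathcal J(X)\to\mathcal B(X)\to\mathcal B(X)/\mathcal J(X)\to\{0\}$$ given by the inclusion and the quotient map. (i) If $\Sigma_X$ splits algebraically, then $K_0(\mathcal B(X))$ contains a subgroup isomorphic to $\mathbb Z$. In particular, $\Sigma_X$ does not split algebraically if $K_0(\mathcal B(X))=\{0\}$. (ii) For each $m\in\mathbb N$, the space $X^m$ is linearly homeomorphic to one of its proper, closed subspaces of finite codimension if and only if $X^m$ admits a Fredholm operator $X^m\to X^m$ of non-zero index. If this is the case for some $m\in\mathbb N$, then $\Sigma_X$ does not split algebraically. -/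

import Mathlib

namespace BanachKTheory

universe u v

/-! ### The group `K₀` of a unital ring -/

section KZero

/-- Algebraic equivalence of square matrices `P`, `Q`, possibly of different sizes, over a ring:
`P = R T` and `Q = T R` for rectangular matrices `R`, `T`. -/
def MatEquiv {A : Type v} [Ring A] {ι κ : Type} [Fintype ι] [Fintype κ]
    (P : Matrix ι ι A) (Q : Matrix κ κ A) : Prop :=
  ∃ (R : Matrix ι κ A) (T : Matrix κ ι A), P = R * T ∧ Q = T * R

variable {A : Type v} [Ring A] {ι κ μ ν : Type} [Fintype ι] [Fintype κ] [Fintype μ] [Fintype ν]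

theorem MatEquiv.refl {P : Matrix ι ι A} (hP : P * P = P) : MatEquiv P P :=
  ⟨P, P, hP.symm, hP.symm⟩

theorem MatEquiv.symm {P : Matrix ι ι A} {Q : Matrix κ κ A} (h : MatEquiv P Q) :
    MatEquiv Q P := by
  obtain ⟨R, T, h1, h2⟩ := h
  exact ⟨T, R, h2, h1⟩

theorem MatEquiv.trans {P : Matrix ι ι A} {Q : Matrix κ κ A} {S : Matrix μ μ A}
    (hP : P * P = P) (hS : S * S = S) (h : MatEquiv P Q) (h' : MatEquiv Q S) :
    MatEquiv P S := by
  obtain ⟨R, T, h1, h2⟩ := h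
  obtain ⟨R', T', h3, h4⟩ := h'
  refine ⟨R * R', T' * T, ?_, ?_⟩
  · calc P = (R * T) * (R * T) := by rw [← h1, hP]
      _ = R * (T * R) * T := by simp only [Matrix.mul_assoc]
      _ = R * (R' * T') * T := by rw [← h2, h3]
      _ = R * R' * (T' * T) := by simp only [Matrix.mul_assoc]
  · calc S = (T' * R') * (T' * R') := by rw [← h4, hS]
      _ = T' * (R' * T') * R' := by simp only [Matrix.mul_assoc]
      _ = T' * (T * R) * R' := by rw [← h3, h2]
      _ = T' * T * (R * R') := by simp only [Matrix.mul_assoc]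

theorem MatEquiv.submatrix {P : Matrix ι ι A} (hP : P * P = P) (e : κ ≃ ι) :
    MatEquiv P (P.submatrix e e) := by
  refine ⟨P.submatrix id e, P.submatrix e id, ?_, ?_⟩
  · rw [Matrix.submatrix_mul_equiv, hP, Matrix.submatrix_id_id]
  · have h := Matrix.submatrix_mul_equiv P P e (Equiv.refl ι) e
    simp only [Equiv.coe_refl] at h
    rw [h, hP]

/-- The block diagonal matrix with blocks `P` and `Q`. -/
def blockDiag (P : Matrix ι ι A) (Q : Matrix κ κ A) : Matrix (ι ⊕ κ) (ι ⊕ κ) A :=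
  Matrix.fromBlocks P 0 0 Q

theorem blockDiag_idem {P : Matrix ι ι A} {Q : Matrix κ κ A} (hP : P * P = P) (hQ : Q * Q = Q) :
    blockDiag P Q * blockDiag P Q = blockDiag P Q := by
  simp [blockDiag, Matrix.fromBlocks_multiply, hP, hQ]

theorem MatEquiv.blockDiag {P : Matrix ι ι A} {Q : Matrix κ κ A} {P' : Matrix μ μ A}
    {Q' : Matrix ν ν A} (h : MatEquiv P P') (h' : MatEquiv Q Q') :
    MatEquiv (blockDiag P Q) (blockDiag P' Q') := by
  obtain ⟨R, T, rfl, rfl⟩ := h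
  obtain ⟨R', T', rfl, rfl⟩ := h'
  refine ⟨Matrix.fromBlocks R 0 0 R', Matrix.fromBlocks T 0 0 T', ?_, ?_⟩ <;>
    simp [BanachKTheory.blockDiag, Matrix.fromBlocks_multiply]

variable (A) in
/-- Idempotent square matrices of arbitrary finite size over `A`. The empty matrix is allowed;
it is equivalent to the zero matrix of any size, so that it adds no new equivalence class. -/
structure IdemMat where
  size : ℕ
  mat : Matrix (Fin size) (Fin size) A
  idem : mat * mat = mat

/-- The direct sum `P ⊕ Q`, the block diagonal matrix with diagonal blocks `P` and `Q`. -/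
def IdemMat.sum (P Q : IdemMat A) : IdemMat A where
  size := P.size + Q.size
  mat := (blockDiag P.mat Q.mat).submatrix finSumFinEquiv.symm finSumFinEquiv.symm
  idem := by
    rw [Matrix.submatrix_mul_equiv, blockDiag_idem P.idem Q.idem]

variable (A) in
/-- The equivalence relation `∼₀` on idempotent matrices. -/
instance idemSetoid : Setoid (IdemMat A) where
  r P Q := MatEquiv P.mat Q.mat
  iseqv :=
    { refl := fun P => MatEquiv.refl P.idem
      symm := fun h => h.symm
      trans := fun {P _ S} h h' => MatEquiv.trans P.idem S.idem h h' }

theorem IdemMat.sum_equiv (P Q : IdemMat A) :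
    MatEquiv (blockDiag P.mat Q.mat) (P.sum Q).mat :=
  MatEquiv.submatrix (blockDiag_idem P.idem Q.idem) _

theorem IdemMat.sum_congr {P Q P' Q' : IdemMat A} (h : P ≈ P') (h' : Q ≈ Q') :
    P.sum Q ≈ P'.sum Q' :=
  MatEquiv.trans (P.sum Q).idem (P'.sum Q').idem (P.sum_equiv Q).symm
    (MatEquiv.trans (blockDiag_idem P.idem Q.idem) (P'.sum Q').idem
      (MatEquiv.blockDiag h h') (P'.sum_equiv Q'))

variable (A) in
/-- The commutative monoid `V(A)` of equivalence classes of idempotent matrices over `A`. -/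
def VMonoid : Type v := Quotient (idemSetoid A)

instance : Zero (VMonoid A) := ⟨Quotient.mk _ ⟨0, 0, by simp⟩⟩

instance : Add (VMonoid A) :=
  ⟨Quotient.map₂ IdemMat.sum fun _ _ h _ _ h' => IdemMat.sum_congr h h'⟩

instance : AddCommMonoid (VMonoid A) where
  nsmul := nsmulRec
  add_assoc := by
    rintro ⟨P⟩ ⟨Q⟩ ⟨S⟩
    refine Quotient.sound (?_ : MatEquiv _ _)
    have hPQS := blockDiag_idem P.idem (blockDiag_idem Q.idem S.idem)
    have h1 : MatEquiv ((P.sum Q).sum S).mat (blockDiag (blockDiag P.mat Q.mat) S.mat) :=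
      MatEquiv.trans ((P.sum Q).sum S).idem
        (blockDiag_idem (blockDiag_idem P.idem Q.idem) S.idem) ((P.sum Q).sum_equiv S).symm
        (MatEquiv.blockDiag (P.sum_equiv Q).symm (MatEquiv.refl S.idem))
    have h2 : MatEquiv (blockDiag P.mat (blockDiag Q.mat S.mat)) (P.sum (Q.sum S)).mat :=
      MatEquiv.trans hPQS (P.sum (Q.sum S)).idem
        (MatEquiv.blockDiag (MatEquiv.refl P.idem) (Q.sum_equiv S)) (P.sum_equiv (Q.sum S))
    have h3 : MatEquiv (blockDiag (blockDiag P.mat Q.mat) S.mat)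
        (blockDiag P.mat (blockDiag Q.mat S.mat)) := by
      have h4 := (MatEquiv.submatrix hPQS
        (Equiv.sumAssoc (Fin P.size) (Fin Q.size) (Fin S.size))).symm
      convert h4 using 1
      ext ((i | i) | i) ((j | j) | j) <;> rfl
    exact MatEquiv.trans ((P.sum Q).sum S).idem (P.sum (Q.sum S)).idem
      (MatEquiv.trans ((P.sum Q).sum S).idem hPQS h1 h3) h2
  zero_add := by
    rintro ⟨P⟩
    refine Quotient.sound (?_ : MatEquiv _ _)
    refine MatEquiv.trans (IdemMat.idem _) P.idem (IdemMat.sum_equiv _ P).symm ?_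
    have h4 := (MatEquiv.submatrix P.idem (Equiv.emptySum (Fin 0) (Fin P.size))).symm
    convert h4 using 1
    ext (i | i) (j | j)
    · exact i.elim0
    · exact i.elim0
    · exact j.elim0
    · rfl
  add_zero := by
    rintro ⟨P⟩
    refine Quotient.sound (?_ : MatEquiv _ _)
    refine MatEquiv.trans (IdemMat.idem _) P.idem (IdemMat.sum_equiv P _).symm ?_
    have h4 := (MatEquiv.submatrix P.idem (Equiv.sumEmpty (Fin P.size) (Fin 0))).symm
    convert h4 using 1
    ext (i | i) (j | j)
    · rfl
    · exact j.elim0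
    · exact i.elim0
    · exact i.elim0
  add_comm := by
    rintro ⟨P⟩ ⟨Q⟩
    refine Quotient.sound (?_ : MatEquiv _ _)
    have hQP := blockDiag_idem Q.idem P.idem
    have h3 : MatEquiv (blockDiag P.mat Q.mat) (blockDiag Q.mat P.mat) := by
      have h4 := (MatEquiv.submatrix hQP (Equiv.sumComm (Fin P.size) (Fin Q.size))).symm
      convert h4 using 1
      ext (i | i) (j | j) <;> rfl
    exact MatEquiv.trans (P.sum Q).idem (Q.sum P).idem
      (MatEquiv.trans (P.sum Q).idem hQP (P.sum_equiv Q).symm h3) (Q.sum_equiv P)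

variable (A) in
/-- `K₀(A)`, the Grothendieck group of `V(A)`, for a unital ring `A`. -/
abbrev KZero : Type v := Algebra.GrothendieckAddGroup (VMonoid A)

end KZero

/-! ### Short exact sequences of algebras -/

/-- A short exact sequence `0 → A → B → C → 0` of complex algebras, not necessarily unital. -/
structure AlgShortExact (A B C : Type v) [NonUnitalRing A] [Module ℂ A] [NonUnitalRing B]
    [Module ℂ B] [NonUnitalRing C] [Module ℂ C] where
  incl : A →ₙₐ[ℂ] B
  proj : B →ₙₐ[ℂ] C
  incl_injective : Function.Injective incl
  exact : Function.Exact incl proj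
  proj_surjective : Function.Surjective proj

/-- The sequence splits algebraically: the second map has a right inverse that is a homomorphism
of algebras. It need be neither unital nor continuous. -/
def AlgShortExact.SplitsAlgebraically {A B C : Type v} [NonUnitalRing A] [Module ℂ A]
    [NonUnitalRing B] [Module ℂ B] [NonUnitalRing C] [Module ℂ C]
    (E : AlgShortExact A B C) : Prop :=
  ∃ θ : C →ₙₐ[ℂ] B, E.proj.comp θ = NonUnitalAlgHom.id ℂ C

/-! ### Operators on Banach spaces -/

/-- The complex vector space `X` is infinite-dimensional. -/
class InfiniteDimensional (X : Type u) [AddCommGroup X] [Module ℂ X] : Prop where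
  not_finiteDimensional : ¬ FiniteDimensional ℂ X

/-- `S` is strictly singular: every subspace on which `S` is bounded below is
finite-dimensional. -/
def StrictlySingular {X Y : Type u} [NormedAddCommGroup X] [NormedSpace ℂ X]
    [NormedAddCommGroup Y] [NormedSpace ℂ Y] (S : X →L[ℂ] Y) : Prop :=
  ∀ W : Submodule ℂ X, (∃ c : ℝ, 0 < c ∧ ∀ x ∈ W, c * ‖x‖ ≤ ‖S x‖) → FiniteDimensional ℂ W

/-- An ideal of operators: a subspace of `B(X, Y)` for each pair of infinite-dimensional complex
Banach spaces `X`, `Y`, stable under composition with operators on both sides. -/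
structure OperatorIdeal where
  carrier : ∀ (X Y : Type u) [NormedAddCommGroup X] [NormedSpace ℂ X] [CompleteSpace X]
    [InfiniteDimensional X] [NormedAddCommGroup Y] [NormedSpace ℂ Y] [CompleteSpace Y]
    [InfiniteDimensional Y], Submodule ℂ (X →L[ℂ] Y)
  comp_mem : ∀ {W X Y Z : Type u} [NormedAddCommGroup W] [NormedSpace ℂ W] [CompleteSpace W]
    [InfiniteDimensional W] [NormedAddCommGroup X] [NormedSpace ℂ X] [CompleteSpace X]
    [InfiniteDimensional X] [NormedAddCommGroup Y] [NormedSpace ℂ Y] [CompleteSpace Y]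
    [InfiniteDimensional Y] [NormedAddCommGroup Z] [NormedSpace ℂ Z] [CompleteSpace Z]
    [InfiniteDimensional Z] (T : Y →L[ℂ] Z) (S : X →L[ℂ] Y) (R : W →L[ℂ] X),
    S ∈ carrier X Y → (T.comp S).comp R ∈ carrier W Z

namespace OperatorIdeal

/-- `J(X, Y)` is closed in `B(X, Y)` for all `X`, `Y`. -/
def Closed (J : OperatorIdeal.{u}) : Prop :=
  ∀ (X Y : Type u) [NormedAddCommGroup X] [NormedSpace ℂ X] [CompleteSpace X]
    [InfiniteDimensional X] [NormedAddCommGroup Y] [NormedSpace ℂ Y] [CompleteSpace Y]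
    [InfiniteDimensional Y], IsClosed (J.carrier X Y : Set (X →L[ℂ] Y))

/-- `J(X, Y) ≠ {0}` for all `X`, `Y`. -/
def NonZero (J : OperatorIdeal.{u}) : Prop :=
  ∀ (X Y : Type u) [NormedAddCommGroup X] [NormedSpace ℂ X] [CompleteSpace X]
    [InfiniteDimensional X] [NormedAddCommGroup Y] [NormedSpace ℂ Y] [CompleteSpace Y]
    [InfiniteDimensional Y], J.carrier X Y ≠ ⊥

/-- `J` is contained in the ideal of strictly singular operators. -/
def InStrictlySingular (J : OperatorIdeal.{u}) : Prop :=
  ∀ (X Y : Type u) [NormedAddCommGroup X] [NormedSpace ℂ X] [CompleteSpace X]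
    [InfiniteDimensional X] [NormedAddCommGroup Y] [NormedSpace ℂ Y] [CompleteSpace Y]
    [InfiniteDimensional Y] (S : X →L[ℂ] Y), S ∈ J.carrier X Y → StrictlySingular S

variable (J : OperatorIdeal.{u}) (X : Type u) [NormedAddCommGroup X] [NormedSpace ℂ X]
  [CompleteSpace X] [InfiniteDimensional X]

/-- `J(X) = J(X, X)` as an ideal of the ring `B(X)`. -/
def ideal : Ideal (X →L[ℂ] X) where
  carrier := J.carrier X X
  add_mem' := (J.carrier X X).add_mem
  zero_mem' := (J.carrier X X).zero_mem
  smul_mem' T _ hS := J.comp_mem T _ (ContinuousLinearMap.id ℂ X) hS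

instance : (J.ideal X).IsTwoSided where
  mul_mem_of_left R hS := J.comp_mem (ContinuousLinearMap.id ℂ X) _ R hS

/-- `J(X)` as a subalgebra of `B(X)`, in general without identity. -/
def subalgebra : NonUnitalSubalgebra ℂ (X →L[ℂ] X) where
  carrier := J.carrier X X
  add_mem' := (J.carrier X X).add_mem
  zero_mem' := (J.carrier X X).zero_mem
  smul_mem' c _ hS := (J.carrier X X).smul_mem c hS
  mul_mem' {T _} _ hS := J.comp_mem T _ (ContinuousLinearMap.id ℂ X) hS

/-- The short exact sequence `0 → J(X) → B(X) → B(X)/J(X) → 0`, with the inclusion and the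
quotient map. -/
def sequence : AlgShortExact (J.subalgebra X) (X →L[ℂ] X) ((X →L[ℂ] X) ⧸ J.ideal X) where
  incl := NonUnitalSubalgebraClass.subtype (J.subalgebra X)
  proj := (Ideal.Quotient.mkₐ ℂ (J.ideal X) : (X →L[ℂ] X) →ₙₐ[ℂ] ((X →L[ℂ] X) ⧸ J.ideal X))
  incl_injective := Subtype.val_injective
  exact := by
    intro T
    constructor
    · intro h
      exact ⟨⟨T, Ideal.Quotient.eq_zero_iff_mem.mp h⟩, rfl⟩
    · rintro ⟨S, rfl⟩
      exact Ideal.Quotient.eq_zero_iff_mem.mpr S.2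
  proj_surjective := Ideal.Quotient.mk_surjective

end OperatorIdeal

/-- `X` is linearly homeomorphic to a proper, closed subspace of finite codimension of `X`. -/
def IsoToProperFiniteCodim (X : Type u) [NormedAddCommGroup X] [NormedSpace ℂ X] : Prop :=
  ∃ W : Submodule ℂ X, IsClosed (W : Set X) ∧ W ≠ ⊤ ∧ FiniteDimensional ℂ (X ⧸ W) ∧
    Nonempty (X ≃L[ℂ] W)

/-- The index `dim ker T - codim im T` of a Fredholm operator (meaningful only for those). -/
noncomputable def fredholmIndex {X : Type u} [NormedAddCommGroup X] [NormedSpace ℂ X]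
    (T : X →L[ℂ] X) : ℤ :=
  (Module.finrank ℂ T.ker : ℤ) - (Module.finrank ℂ (X ⧸ T.range) : ℤ)

end BanachKTheory

open BanachKTheory

universe u

namespace BanachKTheory

universe v

/-! ### Index-zero operators -/

section IndexZero

open Submodule LinearMap

/-! A splitting `θ` lifts every unit of a matrix ring over B(X)/J(X) to a unit over B(X), namely `θ
s + (1 - θ 1)` for entrywise `θ`. Let `a * b = 1` with `b * a ≡ 1` modulo J. If `u` is a unit
lifting the class of `a`, then `u⁻¹ * a` is the identity minus a matrix over J, which acts on a
power of X as 1 - K with K strictly singular. Such a 1 - K has index zero, so its right inverse `b *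
u` is also a left inverse and `b * a = 1` (`OperatorIdeal.mul_eq_one_of_splits`).

Both parts rest on this rigidity. An isomorphism of a power of X onto a proper closed subspace of
finite codimension has a left inverse that is two-sided modulo finite rank, hence modulo J; rigidity
would make the subspace everything. For K₀, let `e` be a rank-one idempotent: if n[e] = 0 with n >
0, then n copies of `e` are absorbed by an identity matrix, which rigidity also forbids.

Index zero here means "invertible plus finite rank". That 1 - K is of this kind follows by deforming
tK from t = 0 to t = 1 (`StrictlySingular.isIndexZero_one_sub`). -/

theorem injective_one_add_iff_surjective {k V : Type*} [Field k] [AddCommGroup V] [Module k V]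
    (F : V →ₗ[k] V) [FiniteDimensional k F.range] :
    Function.Injective (1 + F : Module.End k V) ↔ Function.Surjective (1 + F : Module.End k V) := by
  have hmem : ∀ x ∈ F.range, (1 + F : Module.End k V) x ∈ F.range := fun x hx =>
    F.range.add_mem hx ⟨x, rfl⟩
  have hback : ∀ x, (1 + F : Module.End k V) x ∈ F.range → x ∈ F.range := fun x hx => by
    have := F.range.sub_mem hx ⟨x, rfl⟩
    simpa using this
  -- Since `1 + F` is the identity modulo the range of `F`, both properties are decided on that
  -- finite-dimensional range.
  set f := LinearMap.restrict (1 + F : Module.End k V) hmem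
  have key : Function.Injective f ↔ Function.Surjective f := LinearMap.injective_iff_surjective
  constructor
  · intro h y
    have hf : Function.Injective f := fun a b hab => Subtype.ext (h (congrArg Subtype.val hab))
    obtain ⟨r, hr⟩ := key.1 hf ⟨F y, y, rfl⟩
    have hr' : (r : V) + F r = F y := congrArg Subtype.val hr
    refine ⟨y - r, ?_⟩
    rw [map_sub]
    change y + F y - (r + F r) = y
    rw [hr', add_sub_cancel_right]
  · intro h
    have hf : Function.Surjective f := fun r => by
      obtain ⟨x, hx⟩ := h r
      exact ⟨⟨x, hback x (hx ▸ r.2)⟩, Subtype.ext hx⟩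
    rw [injective_iff_map_eq_zero]
    intro x hx
    have hxr : x ∈ F.range := hback x (hx ▸ F.range.zero_mem)
    have : (⟨x, hxr⟩ : F.range) = 0 := key.2 hf (by
      rw [map_zero]
      exact Subtype.ext hx)
    exact congrArg Subtype.val this

variable {Y Z : Type*} [NormedAddCommGroup Y] [NormedSpace ℂ Y]
  [NormedAddCommGroup Z] [NormedSpace ℂ Z]

/-- An operator is Fredholm of index zero: the sum of an invertible and a finite-rank operator. -/
def IsIndexZero (A : Y →L[ℂ] Y) : Prop :=
  ∃ U F : Y →L[ℂ] Y, IsUnit U ∧ FiniteDimensional ℂ F.range ∧ A = U + F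

theorem IsIndexZero.injective_iff_surjective {A : Y →L[ℂ] Y} (hA : IsIndexZero A) :
    Function.Injective A ↔ Function.Surjective A := by
  obtain ⟨_, F, ⟨U, rfl⟩, hF, rfl⟩ := hA
  set G : Y →L[ℂ] Y := (↑U⁻¹ : Y →L[ℂ] Y) * F
  have hG : FiniteDimensional ℂ (G : Y →ₗ[ℂ] Y).range := by
    have : (G : Y →ₗ[ℂ] Y).range = F.range.map ((↑U⁻¹ : Y →L[ℂ] Y) : Y →ₗ[ℂ] Y) :=
      LinearMap.range_comp _ _
    rw [this]
    infer_instance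
  have h1 : (U : Y →L[ℂ] Y) + F = U * (1 + G) := by
    simp [G, mul_add]
  have hU : Function.Bijective (U : Y →L[ℂ] Y) := by
    refine Function.bijective_iff_has_inverse.2 ⟨(↑U⁻¹ : Y →L[ℂ] Y), fun x => ?_, fun x => ?_⟩
    · rw [← mul_apply_eq_comp, Units.inv_mul, one_apply_eq_self]
    · rw [← mul_apply_eq_comp, Units.mul_inv, one_apply_eq_self]
  have h2 : ⇑((U : Y →L[ℂ] Y) + F) = (U : Y →L[ℂ] Y) ∘ (1 + (G : Y →ₗ[ℂ] Y) : Module.End ℂ Y) := by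
    rw [h1]
    rfl
  rw [h2, hU.injective.of_comp_iff, Function.Surjective.of_comp_iff' hU]
  exact injective_one_add_iff_surjective _

theorem IsIndexZero.add_finiteRank {A F : Y →L[ℂ] Y} (hA : IsIndexZero A)
    (hF : FiniteDimensional ℂ F.range) : IsIndexZero (A + F) := by
  obtain ⟨U, F', hU, hF', rfl⟩ := hA
  refine ⟨U, F' + F, hU, ?_, add_assoc _ _ _⟩
  exact Submodule.finiteDimensional_of_le
    (LinearMap.range_add_le (F' : Y →ₗ[ℂ] Y) (F : Y →ₗ[ℂ] Y))

theorem isIndexZero_of_isUnit {A : Y →L[ℂ] Y} (hA : IsUnit A) : IsIndexZero A :=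
  ⟨A, 0, hA, by
    rw [show ((0 : Y →L[ℂ] Y) : Y →ₗ[ℂ] Y) = 0 from rfl, LinearMap.range_zero]
    infer_instance, (add_zero A).symm⟩

theorem isOpen_setOf_isIndexZero [CompleteSpace Y] : IsOpen {A : Y →L[ℂ] Y | IsIndexZero A} := by
  rw [isOpen_iff_mem_nhds]
  rintro _ ⟨U, F, hU, hF, rfl⟩
  have h1 : {B : Y →L[ℂ] Y | IsUnit (B - F)} ∈ nhds (U + F) := by
    have : ContinuousAt (fun B : Y →L[ℂ] Y => B - F) (U + F) := by fun_prop
    refine this (Units.isOpen.mem_nhds ?_)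
    simpa using hU
  filter_upwards [h1] with B hB
  exact ⟨B - F, F, hB, hF, (sub_add_cancel B F).symm⟩

/-- The lower bound of `A` passes to `B` with constant `c / 2`, so ‖B⁻¹‖ ≤ 2/c and `A` lies in the
ball around `B` that consists of units. -/
theorem isUnit_of_norm_sub_lt [CompleteSpace Y] {A B : Y →L[ℂ] Y} {c : ℝ} (hc : 0 < c)
    (hA : ∀ x, c * ‖x‖ ≤ ‖A x‖) (hB : IsUnit B) (hAB : ‖A - B‖ < c / 2) : IsUnit A := by
  obtain ⟨U, rfl⟩ := hB
  rcases subsingleton_or_nontrivial Y with hY | hY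
  · rw [Subsingleton.elim A U]
    exact U.isUnit
  have h1 : ‖(↑U⁻¹ : Y →L[ℂ] Y)‖ ≤ 2 / c := by
    refine ContinuousLinearMap.opNorm_le_bound _ (by positivity) fun y => ?_
    set x := (↑U⁻¹ : Y →L[ℂ] Y) y
    have hx : (U : Y →L[ℂ] Y) x = y := by
      rw [← mul_apply_eq_comp, Units.mul_inv, one_apply_eq_self]
    have h2 : ‖(A - U) x‖ ≤ c / 2 * ‖x‖ := ContinuousLinearMap.le_of_opNorm_le _ hAB.le x
    have h3 : A x = (A - U) x + y := by simp [hx]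
    have h4 := norm_add_le ((A - U) x) y
    rw [← h3] at h4
    have h5 := hA x
    rw [div_mul_eq_mul_div, le_div_iff₀ hc]
    linarith
  have h0 : 0 < ‖(↑U⁻¹ : Y →L[ℂ] Y)‖ := Units.norm_pos _
  refine (Units.ofNearby U A (hAB.trans_le ?_)).isUnit
  rw [le_inv_comm₀ (by positivity) h0]
  simpa using h1

/-- The tool for finite-rank corrections: `A` is kept on `V` and replaced on `N` by a lift of `g`,
continuous because `N` is finite-dimensional. The next lemmas read injectivity and surjectivity of
`B` off `g`. -/
theorem exists_eqOn_of_quotient (A : Y →L[ℂ] Z) {V N : Submodule ℂ Y} (h : IsTopCompl V N)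
    [FiniteDimensional ℂ N] (g : N →ₗ[ℂ] Z ⧸ V.map (A : Y →ₗ[ℂ] Z)) :
    ∃ B : Y →L[ℂ] Z, (∀ v ∈ V, B v = A v) ∧ ∀ n : N, (V.map (A : Y →ₗ[ℂ] Z)).mkQ (B n) = g n := by
  obtain ⟨G, hG⟩ := Module.projective_lifting_property (V.map (A : Y →ₗ[ℂ] Z)).mkQ g
    (mkQ_surjective _)
  refine ⟨A ∘L V.projectionL N h + G.toContinuousLinearMap ∘L N.projectionOntoL V h.symm,
    fun v hv => ?_, fun n => ?_⟩
  · have h1 := projectionL_apply_left h ⟨v, hv⟩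
    have h2 := projectionOntoL_apply_right h.symm ⟨v, hv⟩
    rw [_root_.add_apply, ContinuousLinearMap.comp_apply, ContinuousLinearMap.comp_apply, h1, h2,
      map_zero, add_zero]
  · have h1 := projectionL_apply_right h n
    have h2 := projectionOntoL_apply_left h.symm n
    rw [← hG, _root_.add_apply, ContinuousLinearMap.comp_apply, ContinuousLinearMap.comp_apply, h1, h2,
      map_zero, zero_add]
    rfl

variable {A B : Y →L[ℂ] Z} {V N : Submodule ℂ Y}
  {g : N →ₗ[ℂ] Z ⧸ V.map (A : Y →ₗ[ℂ] Z)}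

theorem injective_of_quotient_injective (h : IsCompl V N) (hBV : ∀ v ∈ V, B v = A v)
    (hBN : ∀ n : N, (V.map (A : Y →ₗ[ℂ] Z)).mkQ (B n) = g n)
    (hA : ∀ v ∈ V, A v = 0 → v = 0)
    (hg : Function.Injective g) : Function.Injective B := by
  rw [injective_iff_map_eq_zero]
  intro x hx
  obtain ⟨v, hv, n, hn, rfl⟩ := Submodule.mem_sup.1 (h.sup_eq_top ▸ mem_top : x ∈ V ⊔ N)
  have h1 : B n = A (-v) := by
    rw [map_neg, ← hBV v hv, eq_neg_iff_add_eq_zero, add_comm, ← map_add, hx]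
  have h2 : g ⟨n, hn⟩ = 0 := by
    rw [← hBN ⟨n, hn⟩, mkQ_apply, Submodule.Quotient.mk_eq_zero, h1]
    exact ⟨-v, V.neg_mem hv, rfl⟩
  have h3 : n = 0 := congrArg Subtype.val (hg (h2.trans (map_zero g).symm))
  subst h3
  rw [add_zero] at hx ⊢
  exact hA v hv (hBV v hv ▸ hx)

theorem surjective_iff_quotient_surjective (h : IsCompl V N) (hBV : ∀ v ∈ V, B v = A v)
    (hBN : ∀ n : N, (V.map (A : Y →ₗ[ℂ] Z)).mkQ (B n) = g n) :
    Function.Surjective B ↔ Function.Surjective g := by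
  constructor
  · intro hB y
    obtain ⟨z, rfl⟩ := mkQ_surjective _ y
    obtain ⟨x, rfl⟩ := hB z
    obtain ⟨v, hv, n, hn, rfl⟩ := Submodule.mem_sup.1 (h.sup_eq_top ▸ mem_top : x ∈ V ⊔ N)
    refine ⟨⟨n, hn⟩, ?_⟩
    rw [← hBN, map_add, map_add, right_eq_add, mkQ_apply, Submodule.Quotient.mk_eq_zero]
    exact ⟨v, hv, (hBV v hv).symm⟩
  · intro hg y
    obtain ⟨n, hn⟩ := hg ((V.map (A : Y →ₗ[ℂ] Z)).mkQ y)
    rw [← hBN, ← sub_eq_zero, ← map_sub, mkQ_apply, Submodule.Quotient.mk_eq_zero] at hn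
    obtain ⟨v, hv, hvn⟩ := hn
    refine ⟨n - v, ?_⟩
    have hvn' : A v = B n - y := hvn
    rw [map_sub, hBV v hv, hvn', sub_sub_cancel]

theorem quotient_injective_of_injective (h : IsCompl V N) (hBV : ∀ v ∈ V, B v = A v)
    (hBN : ∀ n : N, (V.map (A : Y →ₗ[ℂ] Z)).mkQ (B n) = g n)
    (hB : Function.Injective B) : Function.Injective g := by
  rw [injective_iff_map_eq_zero]
  intro n hn
  rw [← hBN, mkQ_apply, Submodule.Quotient.mk_eq_zero] at hn
  obtain ⟨v, hv, hvn⟩ := hn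
  have h1 : B v = B n := (hBV v hv).trans hvn
  have h2 := hB h1
  have h3 : (n : Y) ∈ V ⊓ N := ⟨h2 ▸ hv, n.2⟩
  rw [h.inf_eq_bot] at h3
  exact Subtype.ext h3

theorem finiteDimensional_range_sub (hBV : ∀ v ∈ V, B v = A v) [FiniteDimensional ℂ (Y ⧸ V)] :
    FiniteDimensional ℂ (B - A).range := by
  have : V ≤ (B - A).ker := fun v hv => by simp [hBV v hv]
  have h2 : FiniteDimensional ℂ (Y ⧸ (B - A).ker) :=
    CoFG.of_le this (inferInstance : FiniteDimensional ℂ (Y ⧸ V))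
  exact ((B - A : Y →L[ℂ] Z) : Y →ₗ[ℂ] Z).quotKerEquivRange.finiteDimensional

theorem finiteDimensional_ker_of_disjoint
    [hfin : FiniteDimensional ℂ (Y ⧸ V)] (hB : ∀ x ∈ V, B x = 0 → x = 0) :
    FiniteDimensional ℂ B.ker := by
  have hdisj : Disjoint (B : Y →ₗ[ℂ] Z).ker V := by
    rw [Submodule.disjoint_def]
    exact fun x h0 hx => hB x hx h0
  exact Module.Finite.of_fg (CoFG.fg_of_disjoint hdisj hfin)

end IndexZero

/-! ### Strictly singular perturbations of the identity are bounded below on finite codimension. -/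

section StrictlySingular

open Submodule LinearMap

/-- A sequence with a lower triangular sequence of functionals of norm at most one has
coordinate functionals of at most geometric growth. -/
theorem norm_coeff_le_of_triangular {Y : Type*} [NormedAddCommGroup Y] [NormedSpace ℂ Y]
    {x : ℕ → Y} {f : ℕ → Y →L[ℂ] ℂ} (hx : ∀ n, ‖x n‖ ≤ 1) (hf : ∀ n, ‖f n‖ ≤ 1)
    (hfx : ∀ n, f n (x n) = 1) (hlt : ∀ m n, m < n → f m (x n) = 0) (N : ℕ) (a : ℕ → ℂ) (j : ℕ)
    (hj : j < N) :
    ‖a j‖ ≤ 2 ^ j * ‖∑ i ∈ Finset.range N, a i • x i‖ := by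
  induction j using Nat.strong_induction_on with
  | _ j ih =>
    set y := ∑ i ∈ Finset.range N, a i • x i with hy
    have h1 : f j y = (∑ i ∈ Finset.range j, a i * f j (x i)) + a j := by
      have h0 : f j y = ∑ i ∈ Finset.range (j + 1), a i * f j (x i) := by
        rw [hy, map_sum]
        simp only [map_smul, smul_eq_mul]
        refine (Finset.sum_subset (Finset.range_subset_range.2 hj) fun i _ hi => ?_).symm
        rw [hlt j i (by simpa using hi), mul_zero]
      rw [h0, Finset.sum_range_succ, hfx, mul_one]
    have h2 : ‖f j y‖ ≤ ‖y‖ := by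
      simpa using ContinuousLinearMap.le_of_opNorm_le _ (hf j) y
    -- The growth rate comes from 1 + ∑_{i<j} 2^i = 2^j.
    have h3 : ‖∑ i ∈ Finset.range j, a i * f j (x i)‖ ≤ (2 ^ j - 1) * ‖y‖ := by
      calc _ ≤ ∑ i ∈ Finset.range j, 2 ^ i * ‖y‖ := by
            refine norm_sum_le_of_le _ fun i hi => ?_
            have hi := Finset.mem_range.1 hi
            have h4 : ‖f j (x i)‖ ≤ 1 :=
              (ContinuousLinearMap.le_of_opNorm_le _ (hf j) _).trans (by simpa using hx i)
            rw [norm_mul]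
            exact (mul_le_of_le_one_right (norm_nonneg _) h4).trans (ih i hi (hi.trans hj))
        _ = (2 ^ j - 1) * ‖y‖ := by
            rw [← Finset.sum_mul, geom_sum_eq (by norm_num)]
            norm_num
    have h5 : a j = f j y - ∑ i ∈ Finset.range j, a i * f j (x i) := by rw [h1]; ring
    calc ‖a j‖ ≤ ‖y‖ + (2 ^ j - 1) * ‖y‖ := by
          rw [h5]
          exact (norm_sub_le _ _).trans (add_le_add h2 h3)
      _ = _ := by ring

variable {Y Z : Type*} [NormedAddCommGroup Y] [NormedSpace ℂ Y]
  [NormedAddCommGroup Z] [NormedSpace ℂ Z]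

/-- An operator that is not bounded below on any closed subspace of finite codimension is small
on some infinite-dimensional subspace. -/
theorem exists_small_on_infinite_dimensional (A : Y →L[ℂ] Z)
    (hA : ∀ V : Submodule ℂ Y, IsClosed (V : Set Y) → V.CoFG → ∀ c : ℝ, 0 < c →
      ∃ x ∈ V, ‖A x‖ < c * ‖x‖) {ε : ℝ} (hε : 0 < ε) :
    ∃ W : Submodule ℂ Y, ¬ FiniteDimensional ℂ W ∧ ∀ x ∈ W, ‖A x‖ ≤ ε * ‖x‖ := by
  -- Each new unit vector is chosen in the common kernel of the earlier functionals and comes with a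
  -- functional norming it. The greedy choice sees only a finite set of predecessors, so the triple
  -- carries its own counter, which sets the required smallness.
  obtain ⟨s, hs, hlt⟩ := exists_seq_of_forall_finset_exists
    (fun p : ℕ × Y × (Y →L[ℂ] ℂ) => ‖p.2.1‖ = 1 ∧ ‖p.2.2‖ ≤ 1 ∧ p.2.2 p.2.1 = 1 ∧
      ‖A p.2.1‖ ≤ ε / 2 * (1 / 4) ^ p.1)
    (fun p q => p.1 < q.1 ∧ p.2.2 q.2.1 = 0) (by
      intro s _
      set G : Y →L[ℂ] (s → ℂ) := ContinuousLinearMap.pi fun p => p.1.2.2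
      set k := s.sup (fun p => p.1) + 1
      obtain ⟨z, hz, hAz⟩ := hA (G : Y →ₗ[ℂ] s → ℂ).ker G.isClosed_ker
        (CoFG.ker (G : Y →ₗ[ℂ] s → ℂ)) (ε / 2 * (1 / 4) ^ k) (by positivity)
      have hz0 : 0 < ‖z‖ := by
        by_contra h0
        have : z = 0 := norm_le_zero_iff.1 (not_lt.1 h0)
        simp [this] at hAz
      set w : Y := ((‖z‖⁻¹ : ℝ) : ℂ) • z with hw
      have hw1 : ‖w‖ = 1 := by
        rw [hw, norm_smul, Complex.norm_real, norm_inv, norm_norm, inv_mul_cancel₀ hz0.ne']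
      obtain ⟨f, hf, hfw⟩ := exists_dual_vector'' ℂ w
      refine ⟨(k, w, f), ⟨hw1, hf, by simpa [hw1] using hfw, ?_⟩, fun p hp => ⟨?_, ?_⟩⟩
      · change ‖A w‖ ≤ _
        rw [hw, map_smul, norm_smul, Complex.norm_real, norm_inv, norm_norm,
          inv_mul_le_iff₀ hz0, mul_comm]
        exact hAz.le
      · exact Nat.lt_succ_of_le (Finset.le_sup (f := fun p : ℕ × Y × (Y →L[ℂ] ℂ) => p.1) hp)
      · have : p.2.2 z = 0 := congrFun (LinearMap.mem_ker.1 hz : G z = 0) ⟨p, hp⟩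
        change p.2.2 w = 0
        rw [hw, map_smul, this, smul_zero])
  have hk : ∀ n, n ≤ (s n).1 := fun n =>
    (strictMono_nat_of_lt_succ (f := fun n => (s n).1)
      fun n => (hlt n (n + 1) n.lt_succ_self).1).le_apply
  set x : ℕ → Y := fun n => (s n).2.1
  have key := norm_coeff_le_of_triangular (x := x) (f := fun n => (s n).2.2) (fun n => (hs n).1.le)
    (fun n => (hs n).2.1) (fun n => (hs n).2.2.1) (fun m n h => (hlt m n h).2)
  have hsum : ∀ c : ℕ →₀ ℂ, ∃ N, c.support ⊆ Finset.range N ∧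
      (c.sum fun i a => a • x i) = ∑ i ∈ Finset.range N, c i • x i := fun c => by
    obtain ⟨N, hN⟩ := c.support.exists_nat_subset_range
    exact ⟨N, hN, Finsupp.sum_of_support_subset _ hN _ (by simp)⟩
  have hli : LinearIndependent ℂ x := by
    rw [linearIndependent_iff]
    intro c hc
    obtain ⟨N, hN, hcN⟩ := hsum c
    rw [Finsupp.linearCombination_apply, hcN] at hc
    ext j
    by_contra hj
    have h1 := key N c j (Finset.mem_range.1 (hN (Finsupp.mem_support_iff.2 hj)))
    rw [hc, norm_zero, mul_zero] at h1
    exact hj (norm_le_zero_iff.1 h1)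
  refine ⟨span ℂ (Set.range x), fun h => ?_, fun y hy => ?_⟩
  · have := Module.Finite.finite_basis (Module.Basis.span hli)
    exact not_finite ℕ
  · obtain ⟨c, rfl⟩ := Finsupp.mem_span_range_iff_exists_finsupp.1 hy
    obtain ⟨N, hN, hcN⟩ := hsum c
    rw [hcN, map_sum]
    set y := ∑ i ∈ Finset.range N, c i • x i
    calc _ ≤ ∑ i ∈ Finset.range N, (ε / 2 * ‖y‖) * (1 / 2) ^ i := by
          refine norm_sum_le_of_le _ fun i hi => ?_
          rw [map_smul, norm_smul]
          have h1 := key N c i (Finset.mem_range.1 hi)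
          have h2 : ‖A (x i)‖ ≤ ε / 2 * (1 / 4) ^ i := (hs i).2.2.2.trans (by
            gcongr ε / 2 * ?_
            exact pow_le_pow_of_le_one (by norm_num) (by norm_num) (hk i))
          -- The decay 4^(-i) beats the coefficient growth 2^i; the remaining geometric sum is at
          -- most 2, which explains ε/2.
          calc _ ≤ (2 ^ i * ‖y‖) * (ε / 2 * (1 / 4) ^ i) := by gcongr
            _ = (ε / 2 * ‖y‖) * (2 * (1 / 4)) ^ i := by rw [mul_pow]; ring
            _ = _ := by norm_num
      _ ≤ (ε / 2 * ‖y‖) * 2 := by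
          rw [← Finset.mul_sum]
          gcongr
          rw [geom_sum_eq (by norm_num)]
          have : (0:ℝ) ≤ (1 / 2) ^ N := by positivity
          rw [div_le_iff_of_neg (by norm_num)]
          linarith
      _ = ε * ‖y‖ := by ring

variable {Y : Type u} [NormedAddCommGroup Y] [NormedSpace ℂ Y]

/-- Otherwise `1 - t • K` has norm at most 1/2 on some infinite-dimensional subspace; there `t • K`
is close to the identity, so `K` is bounded below on it. -/
theorem StrictlySingular.exists_bounded_below {K : Y →L[ℂ] Y} (hK : StrictlySingular K) (t : ℂ) :
    ∃ V : Submodule ℂ Y, IsClosed (V : Set Y) ∧ V.CoFG ∧ ∃ c : ℝ, 0 < c ∧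
      ∀ x ∈ V, c * ‖x‖ ≤ ‖(1 - t • K) x‖ := by
  by_contra hne
  push Not at hne
  obtain ⟨W, hW, hWA⟩ := exists_small_on_infinite_dimensional (1 - t • K) hne (ε := 1 / 2)
    (by norm_num)
  have h1 : ∀ x ∈ W, 1 / 2 * ‖x‖ ≤ ‖t‖ * ‖K x‖ := fun x hx => by
    have h2 := hWA x hx
    have h3 : x = (1 - t • K) x + t • K x := by simp
    have h4 := norm_add_le ((1 - t • K) x) (t • K x)
    rw [← h3, norm_smul] at h4
    linarith
  refine hW (hK W ⟨1 / 2 / (‖t‖ + 1), by positivity, fun x hx => ?_⟩)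
  rw [div_mul_eq_mul_div, div_le_iff₀ (by positivity)]
  refine (h1 x hx).trans ?_
  nlinarith [norm_nonneg (K x)]

end StrictlySingular

/-! ### Limits of index-zero operators. -/

section IndexZeroClosed

open Submodule LinearMap

variable {Y : Type*} [NormedAddCommGroup Y] [NormedSpace ℂ Y] [CompleteSpace Y]
  {Z : Type*} [NormedAddCommGroup Z] [NormedSpace ℂ Z]

theorem isClosed_map_of_bounded_below {A : Y →L[ℂ] Z} {V : Submodule ℂ Y}
    (hV : IsClosed (V : Set Y)) {c : ℝ} (hc : 0 < c) (hA : ∀ x ∈ V, c * ‖x‖ ≤ ‖A x‖) :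
    IsClosed (V.map (A : Y →ₗ[ℂ] Z) : Set Z) := by
  have : CompleteSpace V := hV.completeSpace_coe
  have h1 : AntilipschitzWith (Real.toNNReal c⁻¹) (A ∘L V.subtypeL) := by
    refine AddMonoidHomClass.antilipschitz_of_bound _ fun x => ?_
    rw [Real.coe_toNNReal _ (by positivity), ← div_eq_inv_mul, le_div_iff₀ hc, mul_comm]
    exact hA x x.2
  have h2 := h1.isClosed_range (A ∘L V.subtypeL).uniformContinuous
  convert h2 using 1
  ext z
  simp

/-- A finite-dimensional kernel has a closed complement, on which `A` is a bijection with continuous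
inverse. -/
theorem hasRightInverse_of_surjective [CompleteSpace Z] {A : Y →L[ℂ] Z} (hA : Function.Surjective A)
    (hker : FiniteDimensional ℂ A.ker) : ∃ S : Z →L[ℂ] Y, A ∘L S = ContinuousLinearMap.id ℂ Z := by
  obtain ⟨C, hC, hcompl⟩ := (Submodule.ClosedComplemented.of_finiteDimensional
    (𝕜 := ℂ) (A : Y →ₗ[ℂ] Z).ker).exists_isClosed_isCompl
  have : CompleteSpace C := hC.completeSpace_coe
  have hinj : (A ∘L C.subtypeL : C →L[ℂ] Z).ker = ⊥ := by
    rw [LinearMap.ker_eq_bot']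
    intro x hx
    have h1 : (x : Y) ∈ (A : Y →ₗ[ℂ] Z).ker ⊓ C := ⟨hx, x.2⟩
    rw [hcompl.inf_eq_bot] at h1
    exact Subtype.ext h1
  have hsurj : (A ∘L C.subtypeL : C →L[ℂ] Z).range = ⊤ := by
    rw [LinearMap.range_eq_top]
    intro z
    obtain ⟨y, rfl⟩ := hA z
    obtain ⟨v, hv, n, hn, rfl⟩ := Submodule.mem_sup.1
      (hcompl.sup_eq_top ▸ mem_top : y ∈ (A : Y →ₗ[ℂ] Z).ker ⊔ C)
    have hv' : A v = 0 := hv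
    exact ⟨⟨n, hn⟩, by simp [hv']⟩
  let e := ContinuousLinearEquiv.ofBijective _ hinj hsurj
  refine ⟨C.subtypeL ∘L (e.symm : Z →L[ℂ] C), ?_⟩
  ext z
  exact e.apply_symm_apply z

/-- A finite-rank correction makes `A` injective with closed range, or surjective with
finite-dimensional kernel. The corrected operator is still a limit of index-zero operators. Nearby
ones inherit its injectivity or surjectivity, hence are invertible, and this forces the corrected
operator to be invertible. -/
theorem isIndexZero_of_mem_closure {A : Y →L[ℂ] Y} {V : Submodule ℂ Y}
    (hV : IsClosed (V : Set Y)) [hfin : FiniteDimensional ℂ (Y ⧸ V)] {c : ℝ} (hc : 0 < c)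
    (hA : ∀ x ∈ V, c * ‖x‖ ≤ ‖A x‖) (hcl : A ∈ closure {B : Y →L[ℂ] Y | IsIndexZero B}) :
    IsIndexZero A := by
  obtain ⟨N, hN⟩ := V.exists_isCompl
  have hfN : FiniteDimensional ℂ N := (V.quotientEquivOfIsCompl N hN).finiteDimensional
  have hVN := hN.isTopCompl_of_finiteDimensional_quotient hV
  have hA0 : ∀ x ∈ V, A x = 0 → x = 0 := fun x hx h0 => by
    have := hA x hx
    rw [h0, norm_zero] at this
    exact norm_le_zero_iff.1 (by nlinarith)
  suffices h : ∃ B : Y →L[ℂ] Y, (∀ v ∈ V, B v = A v) ∧ IsUnit B by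
    obtain ⟨B, hBA, hB⟩ := h
    have h1 := (isIndexZero_of_isUnit hB).add_finiteRank
      (finiteDimensional_range_sub (fun v hv => (hBA v hv).symm) : FiniteDimensional ℂ (A - B).range)
    rwa [add_sub_cancel] at h1
  have happrox : ∀ B : Y →L[ℂ] Y, (∀ v ∈ V, B v = A v) → ∀ ε : ℝ, 0 < ε →
      ∃ B' : Y →L[ℂ] Y, IsIndexZero B' ∧ ‖B - B'‖ < ε := fun B hBA ε hε => by
    obtain ⟨A', hA', hd⟩ := Metric.mem_closure_iff.1 hcl ε hε
    refine ⟨A' + (B - A), IsIndexZero.add_finiteRank hA' (finiteDimensional_range_sub hBA), ?_⟩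
    rw [dist_eq_norm] at hd
    rwa [show B - (A' + (B - A)) = A - A' by abel]
  -- The image of `V` is not known to have finite codimension, so ranks are compared as cardinals:
  -- either `N` embeds in the quotient or `N` maps onto it.
  by_cases hg : ∃ g : N →ₗ[ℂ] Y ⧸ V.map (A : Y →ₗ[ℂ] Y), Function.Injective g
  · obtain ⟨g, hg⟩ := hg
    obtain ⟨B, hBV, hBN⟩ := exists_eqOn_of_quotient A hVN g
    refine ⟨B, hBV, ?_⟩
    have hinj := injective_of_quotient_injective hN hBV hBN hA0 hg
    have hcls : IsClosed (Set.range B) := by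
      have h1 : V.map (B : Y →ₗ[ℂ] Y) = V.map (A : Y →ₗ[ℂ] Y) :=
        SetLike.coe_injective (Set.image_congr hBV)
      have h2 : IsClosed (V.map (B : Y →ₗ[ℂ] Y) : Set Y) :=
        h1 ▸ isClosed_map_of_bounded_below hV hc hA
      have : V.CoFG := hfin
      exact LinearMap.isClosed_range_of_isClosed_map_of_finiteDimensional_quotient h2
    obtain ⟨k, hk⟩ := B.antilipschitz_of_injective_of_isClosed_range hinj hcls
    have hk1 : (0 : ℝ) < k + 1 := by positivity
    have hB : ∀ x, (k + 1 : ℝ)⁻¹ * ‖x‖ ≤ ‖B x‖ := fun x => by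
      have h1 := ZeroHomClass.bound_of_antilipschitz B hk x
      rw [inv_mul_le_iff₀ hk1]
      nlinarith [norm_nonneg (B x)]
    -- A quarter of the lower bound suffices both for injectivity of `B'` and for the strict bound
    -- `c / 2` in `isUnit_of_norm_sub_lt`.
    obtain ⟨B', hB', hd⟩ := happrox B hBV ((k + 1 : ℝ)⁻¹ / 2 / 2) (by positivity)
    have hB'inj : Function.Injective B' := by
      rw [injective_iff_map_eq_zero]
      intro x hx
      have h1 := ContinuousLinearMap.le_of_opNorm_le _ hd.le x
      have h2 : (B - B') x = B x := by simp [hx]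
      rw [h2] at h1
      have h3 : 0 < (k + 1 : ℝ)⁻¹ := by positivity
      exact norm_le_zero_iff.1 (by nlinarith [hB x])
    refine isUnit_of_norm_sub_lt (by positivity) hB (ContinuousLinearMap.isUnit_iff_bijective.2
      ⟨hB'inj, hB'.injective_iff_surjective.1 hB'inj⟩) (hd.trans ?_)
    have h3 : 0 < (k + 1 : ℝ)⁻¹ := by positivity
    linarith
  · have hrank : Module.rank ℂ (Y ⧸ V.map (A : Y →ₗ[ℂ] Y)) < Module.rank ℂ N := by
      rw [← rank_le_iff_exists_linearMap, not_le] at hg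
      exact hg
    obtain ⟨g', hg'⟩ := rank_le_iff_exists_linearMap.1 hrank.le
    obtain ⟨g, hg⟩ := LinearMap.exists_leftInverse_of_injective g' (LinearMap.ker_eq_bot.2 hg')
    have hgs : Function.Surjective g := fun y => ⟨g' y, LinearMap.congr_fun hg y⟩
    obtain ⟨B, hBV, hBN⟩ := exists_eqOn_of_quotient A hVN g
    refine ⟨B, hBV, ?_⟩
    have hsurj := (surjective_iff_quotient_surjective hN hBV hBN).2 hgs
    obtain ⟨S, hS⟩ := hasRightInverse_of_surjective hsurj
      (finiteDimensional_ker_of_disjoint (V := V) fun x hx h0 => hA0 x hx (hBV x hx ▸ h0))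
    obtain ⟨B', hB', hd⟩ : ∃ B' : Y →L[ℂ] Y, IsIndexZero B' ∧ IsUnit (B' * S) := by
      have h1 : {T : Y →L[ℂ] Y | IsUnit (T * S)} ∈ nhds B := by
        have : ContinuousAt (fun T : Y →L[ℂ] Y => T * S) B := by fun_prop
        refine this (Units.isOpen.mem_nhds ?_)
        change IsUnit (B * S)
        rw [show B * S = 1 from hS]
        exact isUnit_one
      obtain ⟨ε, hε, hball⟩ := Metric.mem_nhds_iff.1 h1
      obtain ⟨B', hB', hd⟩ := happrox B hBV ε hε
      exact ⟨B', hB', hball (by rwa [Metric.mem_ball, dist_comm, dist_eq_norm])⟩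
    have hbij := ContinuousLinearMap.isUnit_iff_bijective.1 hd
    have hsurj' : Function.Surjective B' := Function.Surjective.of_comp (g := S) hbij.2
    have hunit' := ContinuousLinearMap.isUnit_iff_bijective.2
      ⟨hB'.injective_iff_surjective.2 hsurj', hsurj'⟩
    have hSunit : IsUnit S := by
      obtain ⟨u, rfl⟩ := hunit'
      simpa using hd
    obtain ⟨u, rfl⟩ := hSunit
    rw [show B = ↑u⁻¹ from Units.mul_eq_one_iff_eq_inv.1 hS]
    exact Units.isUnit _

end IndexZeroClosed

/-! ### The identity minus a strictly singular operator has index zero. -/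

section StrictlySingular

variable {Y : Type u} [NormedAddCommGroup Y] [NormedSpace ℂ Y] [CompleteSpace Y]

/-- The real t for which 1 - tK has index zero form a clopen set containing 0, and the line is
connected. Closedness uses the lower bound on a subspace of finite codimension, available for every
t. -/
theorem StrictlySingular.isIndexZero_one_sub {K : Y →L[ℂ] Y} (hK : StrictlySingular K) :
    IsIndexZero (1 - K) := by
  have hcont : Continuous fun t : ℝ => (1 - (t : ℂ) • K : Y →L[ℂ] Y) := by fun_prop
  have hclopen : IsClopen {t : ℝ | IsIndexZero (1 - (t : ℂ) • K)} := by
    refine ⟨isClosed_of_closure_subset fun t ht => ?_, isOpen_setOf_isIndexZero.preimage hcont⟩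
    obtain ⟨V, hV, hfin, c, hc, hA⟩ := hK.exists_bounded_below t
    have : FiniteDimensional ℂ (Y ⧸ V) := hfin
    exact isIndexZero_of_mem_closure hV hc hA
      (map_mem_closure (f := fun t : ℝ => (1 - (t : ℂ) • K : Y →L[ℂ] Y)) hcont ht fun _ h => h)
  have h1 : (1 : ℝ) ∈ {t : ℝ | IsIndexZero (1 - (t : ℂ) • K)} := by
    rw [hclopen.eq_univ ⟨0, by simpa using isIndexZero_of_isUnit isUnit_one⟩]
    trivial
  simpa using h1

theorem StrictlySingular.mul_one_sub_eq_one {K c : Y →L[ℂ] Y} (hK : StrictlySingular K)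
    (h : (1 - K) * c = 1) : c * (1 - K) = 1 := by
  have hsurj : Function.Surjective (1 - K : Y →L[ℂ] Y) := fun y => ⟨c y, DFunLike.congr_fun h y⟩
  obtain ⟨u, hu⟩ := ContinuousLinearMap.isUnit_iff_bijective.2
    ⟨hK.isIndexZero_one_sub.injective_iff_surjective.2 hsurj, hsurj⟩
  rw [← hu] at h ⊢
  rw [← Units.mul_eq_one_iff_inv_eq.1 h, Units.inv_mul]

end StrictlySingular

/-! ### Non-zero index and proper subspaces of finite codimension. -/

section Fredholm

open Submodule LinearMap

variable {Y : Type u} [NormedAddCommGroup Y] [NormedSpace ℂ Y] [CompleteSpace Y]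

theorem isoToProperFiniteCodim_of_injective {B : Y →L[ℂ] Y} (hinj : Function.Injective B)
    (hns : ¬ Function.Surjective B) (hcl : IsClosed (B.range : Set Y)) (hfin : B.range.CoFG) :
    IsoToProperFiniteCodim Y :=
  ⟨B.range, hcl, fun h => hns (LinearMap.range_eq_top.1 h), hfin, ⟨B.equivRange hinj hcl⟩⟩

/-- The subspace is the range of `S`, a complement of the kernel of `B`. -/
theorem isoToProperFiniteCodim_of_rightInverse {B S : Y →L[ℂ] Y} (hBS : B * S = 1)
    (hns : ¬ Function.Injective B) (hker : FiniteDimensional ℂ B.ker) :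
    IsoToProperFiniteCodim Y := by
  have hleft : Function.LeftInverse B S := fun y => DFunLike.congr_fun hBS y
  refine isoToProperFiniteCodim_of_injective hleft.injective (fun h => hns ?_) ?_ ?_
  · exact (hleft.rightInverse_of_surjective h).injective
  · exact ContinuousLinearMap.HasLeftInverse.isClosed_range ⟨B, hleft⟩
  · have := ContinuousLinearMap.isTopCompl_range_ker_of_leftInverse (f₁ := S) (f₂ := B) hleft
    exact FG.cofg_of_isCompl this.isCompl.symm (Module.Finite.iff_fg.1 hker)

theorem isoToProperFiniteCodim_iff :
    IsoToProperFiniteCodim Y ↔ ∃ T : Y →L[ℂ] Y, T.IsFredholm ∧ fredholmIndex T ≠ 0 := by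
  constructor
  · rintro ⟨W, hW, hne, hfin, ⟨e⟩⟩
    set T : Y →L[ℂ] Y := W.subtypeL ∘L (e : Y →L[ℂ] W)
    have hinj : Function.Injective T := Subtype.val_injective.comp e.injective
    have hker : T.ker = ⊥ := LinearMap.ker_eq_bot.2 hinj
    have hrange : T.range = W := by
      ext y
      constructor
      · rintro ⟨x, rfl⟩
        exact (e x).2
      · exact fun hy => ⟨e.symm ⟨y, hy⟩, by simp [T]⟩
    refine ⟨T, ⟨?_, hrange ▸ hW, ?_, hrange ▸ hfin, ?_⟩, ?_⟩
    · exact (hW.isClosedMap_subtype_val.comp e.toHomeomorph.isClosedMap).isStrictMap T.continuous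
    · rw [hker]
      infer_instance
    · rw [hker]
      exact closedComplemented_bot
    · have : Nontrivial (Y ⧸ W) := Submodule.Quotient.nontrivial_iff.2 hne
      have h1 : 0 < Module.finrank ℂ (Y ⧸ W) := Module.finrank_pos
      rw [fredholmIndex, hker, hrange, finrank_bot]
      omega
  · rintro ⟨T, hT, hidx⟩
    have hfk := hT.finite_ker
    have hfc := hT.finite_coker
    obtain ⟨V, hcompl⟩ := hT.closedComplemented_ker.exists_isTopCompl
    have hVN := hcompl.symm
    have hfV : FiniteDimensional ℂ (Y ⧸ V) :=
      (V.quotientEquivOfIsCompl _ hVN.isCompl).symm.finiteDimensional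
    have hmap : V.map (T : Y →ₗ[ℂ] Y) = T.range := by
      rw [LinearMap.range_eq_map, ← hVN.isCompl.sup_eq_top, Submodule.map_sup,
        LinearMap.le_ker_iff_map.1 le_rfl, sup_bot_eq]
    have hT0 : ∀ v ∈ V, T v = 0 → v = 0 := fun v hv h0 =>
      (Submodule.disjoint_def.1 hVN.isCompl.disjoint) v hv h0
    rw [fredholmIndex, ← hmap] at hidx
    rw [← hmap] at hfc
    have hcl : IsClosed (V.map (T : Y →ₗ[ℂ] Y) : Set Y) := by
      rw [hmap]
      exact hT.isClosed_range
    set k := Module.finrank ℂ T.ker with hk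
    set n := Module.finrank ℂ (Y ⧸ V.map (T : Y →ₗ[ℂ] Y)) with hn
    -- Redefining `T` on its kernel leaves an operator that is injective but not surjective if `k <
    -- n`, and surjective but not injective if `n < k`.
    rcases lt_or_gt_of_ne (show k ≠ n by omega) with hlt | hlt
    · obtain ⟨g, hg⟩ := finrank_le_iff_exists_linearMap.1 hlt.le
      obtain ⟨B, hBV, hBN⟩ := exists_eqOn_of_quotient T hVN g
      have hle : V.map (T : Y →ₗ[ℂ] Y) ≤ B.range := by
        rintro _ ⟨v, hv, rfl⟩
        exact ⟨v, hBV v hv⟩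
      refine isoToProperFiniteCodim_of_injective
        (injective_of_quotient_injective hVN.isCompl hBV hBN hT0 hg) (fun hs => ?_)
        (isClosed_mono_of_finiteDimensional_quotient hcl hle) (CoFG.of_le hle hfc)
      have := LinearMap.finrank_le_finrank_of_surjective
        ((surjective_iff_quotient_surjective hVN.isCompl hBV hBN).1 hs)
      omega
    · obtain ⟨g', hg'⟩ := finrank_le_iff_exists_linearMap.1 hlt.le
      obtain ⟨g, hg⟩ := LinearMap.exists_leftInverse_of_injective g' (LinearMap.ker_eq_bot.2 hg')
      have hgs : Function.Surjective g := fun y => ⟨g' y, LinearMap.congr_fun hg y⟩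
      obtain ⟨B, hBV, hBN⟩ := exists_eqOn_of_quotient T hVN g
      have hker : FiniteDimensional ℂ B.ker :=
        finiteDimensional_ker_of_disjoint (V := V) fun x hx h0 => hT0 x hx (hBV x hx ▸ h0)
      obtain ⟨S, hS⟩ := hasRightInverse_of_surjective
        ((surjective_iff_quotient_surjective hVN.isCompl hBV hBN).2 hgs) hker
      refine isoToProperFiniteCodim_of_rightInverse hS (fun hi => ?_) hker
      have := LinearMap.finrank_le_finrank_of_injective
        (quotient_injective_of_injective hVN.isCompl hBV hBN hi)
      omega

end Fredholm

/-! ### Matrices over B(X) and the effect of a splitting. -/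

section Matrices

/-- A non-unital ring homomorphism that splits a unital one lifts units to units. -/
theorem exists_unit_lift {R S : Type*} [Ring R] [Ring S] (p : R →+* S) (θ : S →ₙ+* R)
    (hθ : ∀ s, p (θ s) = s) (s : Sˣ) : ∃ u : Rˣ, p u = s := by
  -- `θ 1` is merely an idempotent; the complementary idempotent `1 - θ 1`, killed by `p`, repairs
  -- the missing unit.
  have key : ∀ s t : S, s * t = 1 → (θ s + (1 - θ 1)) * (θ t + (1 - θ 1)) = 1 := fun s t h => by
    have h1 : θ s * θ t = θ 1 := by rw [← map_mul, h]
    have h2 : θ s * θ 1 = θ s := by rw [← map_mul, mul_one]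
    have h3 : θ 1 * θ t = θ t := by rw [← map_mul, one_mul]
    have h4 : θ 1 * θ 1 = θ 1 := by rw [← map_mul, one_mul]
    simp only [mul_add, add_mul, mul_sub, sub_mul, mul_one, one_mul, h1, h2, h3, h4]
    abel
  exact ⟨⟨_, _, key s ↑s⁻¹ s.mul_inv, key ↑s⁻¹ s s.inv_mul⟩, by simp [hθ]⟩

variable {ι : Type} [Fintype ι] [DecidableEq ι] {X : Type u} [NormedAddCommGroup X]
  [NormedSpace ℂ X]

/-- The operator on `X ^ ι` given by a matrix of operators on `X`. -/
noncomputable def matrixOperator (M : Matrix ι ι (X →L[ℂ] X)) : (ι → X) →L[ℂ] (ι → X) :=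
  ∑ i, ∑ j, (ContinuousLinearMap.single ℂ (fun _ : ι => X) i ∘L M i j) ∘L
    ContinuousLinearMap.proj (R := ℂ) (φ := fun _ : ι => X) j

theorem matrixOperator_apply (M : Matrix ι ι (X →L[ℂ] X)) (x : ι → X) (i : ι) :
    matrixOperator M x i = ∑ j, M i j (x j) := by
  simp [matrixOperator, Finset.sum_apply, Pi.single_apply]

theorem matrixOperator_mul (M N : Matrix ι ι (X →L[ℂ] X)) :
    matrixOperator (M * N) = matrixOperator M * matrixOperator N := by
  ext x i
  simp only [matrixOperator_apply, mul_apply_eq_comp, Matrix.mul_apply,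
    sum_apply, map_sum]
  exact Finset.sum_comm

theorem matrixOperator_one : matrixOperator (1 : Matrix ι ι (X →L[ℂ] X)) = 1 := by
  ext x i
  rw [matrixOperator_apply, Finset.sum_eq_single i]
  · simp
  · intro j _ hj
    simp [Matrix.one_apply_ne hj.symm]
  · simp

theorem matrixOperator_sub (M N : Matrix ι ι (X →L[ℂ] X)) :
    matrixOperator (M - N) = matrixOperator M - matrixOperator N := by
  ext x i
  simp [matrixOperator_apply]

theorem matrixOperator_injective :
    Function.Injective (matrixOperator : Matrix ι ι (X →L[ℂ] X) → _) := by
  intro M N h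
  ext i j x
  have := congrFun (DFunLike.congr_fun h (Pi.single j x)) i
  rw [matrixOperator_apply, matrixOperator_apply, Finset.sum_eq_single j, Finset.sum_eq_single j]
    at this
  · simpa using this
  all_goals simp +contextual

/-- The matrix of operators on `X` that represents an operator on `X ^ ι`. -/
noncomputable def operatorMatrix (T : (ι → X) →L[ℂ] (ι → X)) : Matrix ι ι (X →L[ℂ] X) :=
  fun i j => ContinuousLinearMap.proj (R := ℂ) (φ := fun _ : ι => X) i ∘L T ∘L
    ContinuousLinearMap.single ℂ (fun _ : ι => X) j

theorem matrixOperator_operatorMatrix (T : (ι → X) →L[ℂ] (ι → X)) :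
    matrixOperator (operatorMatrix T) = T := by
  ext x i
  rw [matrixOperator_apply]
  conv_rhs => rw [← Finset.univ_sum_single x, map_sum, Finset.sum_apply]
  rfl

variable [CompleteSpace X] [InfiniteDimensional X]

instance [Nonempty ι] : InfiniteDimensional (ι → X) where
  not_finiteDimensional h := by
    obtain ⟨i⟩ := ‹Nonempty ι›
    exact InfiniteDimensional.not_finiteDimensional (X := X)
      (Module.Finite.of_surjective (LinearMap.proj i : (ι → X) →ₗ[ℂ] X)
        (Function.surjective_eval i))

variable {J : OperatorIdeal.{u}}

theorem OperatorIdeal.matrixOperator_mem [Nonempty ι] {M : Matrix ι ι (X →L[ℂ] X)}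
    (hM : M.map (Ideal.Quotient.mk (J.ideal X)) = 0) :
    matrixOperator M ∈ J.carrier (ι → X) (ι → X) :=
  Submodule.sum_mem _ fun i _ => Submodule.sum_mem _ fun j _ => J.comp_mem _ _ _
    (Ideal.Quotient.eq_zero_iff_mem.1 (congrFun (congrFun hM i) j) : M i j ∈ J.ideal X)

theorem OperatorIdeal.mul_eq_one_of_splits (hsing : J.InStrictlySingular)
    (hsplit : (J.sequence X).SplitsAlgebraically) {a b : Matrix ι ι (X →L[ℂ] X)} (hab : a * b = 1)
    (hba : (b * a).map (Ideal.Quotient.mk (J.ideal X)) = 1) : b * a = 1 := by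
  -- The zero space X^∅ is set aside, since the ideal is only defined on infinite-dimensional
  -- spaces.
  cases isEmpty_or_nonempty ι
  · exact Subsingleton.elim _ _
  set p := (Ideal.Quotient.mk (J.ideal X)).mapMatrix (m := ι)
  obtain ⟨θ, hθ⟩ := hsplit
  have hθ' : ∀ s, Ideal.Quotient.mk (J.ideal X) (θ s) = s := DFunLike.congr_fun hθ
  let Θ : Matrix ι ι ((X →L[ℂ] X) ⧸ J.ideal X) →ₙ+* Matrix ι ι (X →L[ℂ] X) :=
    { toFun := fun M => M.map θ
      map_mul' := fun M N => by
        ext1 i j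
        simp [Matrix.mul_apply]
      map_zero' := by ext1 i j; simp
      map_add' := fun M N => by ext1 i j; simp }
  have hpba : p b * p a = 1 := by rw [← map_mul]; exact hba
  obtain ⟨u, hu⟩ := exists_unit_lift p Θ (fun M => by ext1 i j; exact hθ' _)
    ⟨p a, p b, by rw [← map_mul, hab, map_one], hpba⟩
  have hu' : p ↑u⁻¹ * p a = 1 := by
    rw [show p a = p u from hu.symm, ← map_mul, Units.inv_mul, map_one]
  have hK : (1 - (↑u⁻¹ : Matrix ι ι (X →L[ℂ] X)) * a).map
      (Ideal.Quotient.mk (J.ideal X)) = 0 := by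
    change p _ = 0
    rw [map_sub, map_mul, hu', map_one, sub_self]
  have hss : StrictlySingular (matrixOperator (1 - (↑u⁻¹ : Matrix ι ι (X →L[ℂ] X)) * a)) :=
    hsing _ _ _ (J.matrixOperator_mem hK)
  have h1 := hss.mul_one_sub_eq_one (c := matrixOperator (b * (u : Matrix ι ι (X →L[ℂ] X))))
  rw [← matrixOperator_one, ← matrixOperator_sub, sub_sub_cancel, ← matrixOperator_mul,
    ← matrixOperator_mul] at h1
  have h2 := matrixOperator_injective (h1 (congrArg _ (by
    rw [mul_assoc, ← mul_assoc a, hab, one_mul, Units.inv_mul])))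
  rwa [mul_assoc, Units.mul_inv_cancel_left] at h2

/-- Every rank-one operator factors through any non-zero member `S` of the ideal: send `x` with S x
≠ 0 to `S x`, then apply a functional equal to 1 there. -/
theorem OperatorIdeal.smulRight_mem (hnonzero : J.NonZero) (f : X →L[ℂ] ℂ) (y : X) :
    f.smulRight y ∈ J.ideal X := by
  obtain ⟨S, hS, hS0⟩ := Submodule.exists_mem_ne_zero_of_ne_bot (hnonzero X X)
  obtain ⟨x, hx⟩ : ∃ x, S x ≠ 0 := by
    by_contra! h
    exact hS0 (ContinuousLinearMap.ext h)
  obtain ⟨g, hg⟩ := SeparatingDual.exists_eq_one (R := ℂ) hx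
  have h1 : f.smulRight y = (g.smulRight y ∘L S) ∘L f.smulRight x := by
    ext z
    simp [hg]
  rw [h1]
  exact J.comp_mem _ _ _ hS

theorem OperatorIdeal.mem_of_finiteDimensional_range (hnonzero : J.NonZero) {F : X →L[ℂ] X}
    (hF : FiniteDimensional ℂ F.range) : F ∈ J.ideal X := by
  let b := Module.finBasis ℂ F.range
  let G : X →L[ℂ] F.range := F.rangeRestrict
  have h1 : F = ∑ k, ((b.coord k).toContinuousLinearMap ∘L G).smulRight (b k : X) := by
    ext x
    have := congrArg Subtype.val (b.sum_repr (G x))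
    simp only [sum_apply]
    rw [Submodule.coe_sum] at this
    exact this.symm
  rw [h1]
  exact Submodule.sum_mem _ fun k _ => J.smulRight_mem hnonzero _ _

/-- With `T` the embedding onto `W` and `S` its inverse after a projection onto `W`, `S * T = 1` and
`1 - T * S` has finite rank. Rigidity gives `T * S = 1`, so the projection is the identity. -/
theorem OperatorIdeal.not_isoToProperFiniteCodim_of_splits (hnonzero : J.NonZero)
    (hsing : J.InStrictlySingular) (hsplit : (J.sequence X).SplitsAlgebraically) :
    ¬ IsoToProperFiniteCodim (ι → X) := by
  rintro ⟨W, hW, hne, hfin, ⟨e⟩⟩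
  obtain ⟨P, hP⟩ := Submodule.ClosedComplemented.of_finiteDimensional_quotient hW
  set T : (ι → X) →L[ℂ] (ι → X) := W.subtypeL ∘L (e : (ι → X) →L[ℂ] W)
  set S : (ι → X) →L[ℂ] (ι → X) := (e.symm : W →L[ℂ] (ι → X)) ∘L P with hS
  have hST : S * T = 1 := by
    ext1 x
    change e.symm (P (e x)) = x
    rw [hP, e.symm_apply_apply]
  have hTS : ∀ x, (T * S) x = P x := fun x => congrArg Subtype.val (e.apply_symm_apply (P x))
  have hF : FiniteDimensional ℂ (1 - T * S).range :=
    finiteDimensional_range_sub (V := W) fun w hw => by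
      rw [hTS, hP ⟨w, hw⟩]
      rfl
  have hab : operatorMatrix S * operatorMatrix T = 1 := matrixOperator_injective (by
    rw [matrixOperator_mul, matrixOperator_operatorMatrix, matrixOperator_operatorMatrix, hST,
      matrixOperator_one])
  have hsub : 1 - operatorMatrix T * operatorMatrix S = operatorMatrix (1 - T * S) :=
    matrixOperator_injective (by
      rw [matrixOperator_sub, matrixOperator_mul, matrixOperator_operatorMatrix,
        matrixOperator_operatorMatrix, matrixOperator_one, matrixOperator_operatorMatrix])
  have hba : (operatorMatrix T * operatorMatrix S).map (Ideal.Quotient.mk (J.ideal X)) = 1 := by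
    rw [← sub_eq_zero, ← neg_eq_zero, neg_sub,
      ← map_one (Ideal.Quotient.mk (J.ideal X)).mapMatrix]
    change (Ideal.Quotient.mk (J.ideal X)).mapMatrix 1 -
      (Ideal.Quotient.mk (J.ideal X)).mapMatrix (operatorMatrix T * operatorMatrix S) = 0
    rw [← map_sub, hsub]
    ext1 i j
    refine Ideal.Quotient.eq_zero_iff_mem.2 (J.mem_of_finiteDimensional_range hnonzero ?_)
    refine Submodule.finiteDimensional_of_le (S₂ := (1 - T * S).range.map
      (LinearMap.proj i : (ι → X) →ₗ[ℂ] X)) ?_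
    rintro _ ⟨x, rfl⟩
    exact ⟨_, ⟨Pi.single j x, rfl⟩, rfl⟩
  have h1 := congrArg matrixOperator (J.mul_eq_one_of_splits hsing hsplit hab hba)
  rw [matrixOperator_mul, matrixOperator_operatorMatrix, matrixOperator_operatorMatrix,
    matrixOperator_one] at h1
  refine hne (eq_top_iff.2 fun x _ => ?_)
  have h2 := hTS x
  rw [h1] at h2
  exact (show x = P x from h2) ▸ (P x).2

end Matrices

/-! ### A copy of the integers in K₀. -/

section KZero

variable {A : Type v} [Ring A]

/-- The class of an idempotent matrix in `V(A)`. -/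
def IdemMat.toV (P : IdemMat A) : VMonoid A := Quotient.mk _ P

theorem IdemMat.toV_eq_iff {P Q : IdemMat A} : P.toV = Q.toV ↔ MatEquiv P.mat Q.mat :=
  Quotient.eq

theorem IdemMat.toV_sum (P Q : IdemMat A) : (P.sum Q).toV = P.toV + Q.toV := rfl

theorem IdemMat.toV_surjective : Function.Surjective (IdemMat.toV : IdemMat A → VMonoid A) :=
  Quotient.exists_rep

theorem blockDiag_one_sub_matEquiv {ι : Type} [Fintype ι] [DecidableEq ι] {Q : Matrix ι ι A}
    (hQ : Q * Q = Q) : MatEquiv (blockDiag Q (1 - Q)) (1 : Matrix ι ι A) := by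
  refine ⟨Matrix.fromRows Q (1 - Q), Matrix.fromCols Q (1 - Q), ?_, ?_⟩
  · rw [Matrix.fromRows_mul_fromCols, blockDiag]
    simp [mul_sub, sub_mul, hQ]
  · rw [Matrix.fromCols_mul_fromRows]
    simp [mul_sub, sub_mul, hQ]

/-- An idempotent `D` that vanishes in `K₀(A)` can be absorbed by an identity matrix. -/
theorem exists_blockDiag_one_matEquiv {D : IdemMat A} {c : VMonoid A}
    (h : D.toV + c = c) :
    ∃ k : ℕ, MatEquiv (blockDiag D.mat (1 : Matrix (Fin k) (Fin k) A))
      (1 : Matrix (Fin k) (Fin k) A) := by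
  obtain ⟨Q, rfl⟩ := IdemMat.toV_surjective c
  -- Adding the class of the complementary idempotent to both sides turns `c` into the class of an
  -- identity matrix.
  let Q' : IdemMat A := ⟨Q.size, 1 - Q.mat, by simp [mul_sub, sub_mul, Q.idem]⟩
  let I : IdemMat A := ⟨Q.size, 1, one_mul _⟩
  have hI : Q.toV + Q'.toV = I.toV :=
    IdemMat.toV_eq_iff.2 (MatEquiv.trans (Q.sum Q').idem I.idem (Q.sum_equiv Q').symm
      (blockDiag_one_sub_matEquiv Q.idem))
  have h1 : D.toV + I.toV = I.toV := by
    rw [← hI, ← add_assoc, h]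
  have h2 : MatEquiv (D.sum I).mat I.mat := IdemMat.toV_eq_iff.1 h1
  exact ⟨Q.size, MatEquiv.trans (blockDiag_idem D.idem I.idem) I.idem (D.sum_equiv I) h2⟩

/-- If cancellation of one-sided inverses modulo an ideal is possible over `A`, then a nonzero
idempotent matrix with entries in the ideal cannot be absorbed by an identity matrix. -/
theorem eq_zero_of_blockDiag_one_matEquiv {C : Type*} [Ring C] (p : A →+* C) {ι κ : Type}
    [Fintype ι] [Fintype κ] [DecidableEq κ]
    (hp : ∀ a b : Matrix κ κ A, a * b = 1 → (b * a).map p = 1 → b * a = 1)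
    {D : Matrix ι ι A} (hD : D * D = D) (hDp : D.map p = 0)
    (h : MatEquiv (blockDiag D (1 : Matrix κ κ A)) (1 : Matrix κ κ A)) : D = 0 := by
  obtain ⟨R, T, h1, h2⟩ := h
  obtain ⟨R₁, R₂, rfl⟩ : ∃ R₁ R₂, R = Matrix.fromRows R₁ R₂ :=
    ⟨_, _, (Matrix.fromRows_toRows R).symm⟩
  obtain ⟨T₁, T₂, rfl⟩ : ∃ T₁ T₂, T = Matrix.fromCols T₁ T₂ :=
    ⟨_, _, (Matrix.fromCols_toCols T).symm⟩
  rw [Matrix.fromRows_mul_fromCols, blockDiag, Matrix.fromBlocks_inj] at h1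
  rw [Matrix.fromCols_mul_fromRows] at h2
  obtain ⟨h11, h12, -, h22⟩ := h1
  -- This places `T₁ * R₁` in the ideal, so `T₂ * R₂ = 1 - T₁ * R₁` is 1 modulo it while `R₂ * T₂ =
  -- 1`; `hp` applies.
  have hT : T₁ * R₁ = T₁ * D * R₁ := by
    calc T₁ * R₁ = T₁ * (R₁ * (T₁ * R₁ + T₂ * R₂)) := by rw [← h2, Matrix.mul_one]
      _ = T₁ * (R₁ * T₁ * R₁ + R₁ * T₂ * R₂) := by simp only [Matrix.mul_add, Matrix.mul_assoc]
      _ = T₁ * D * R₁ := by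
        rw [← h11, ← h12, Matrix.zero_mul, add_zero, Matrix.mul_assoc]
  have h3 : T₂ * R₂ = 1 - T₁ * R₁ := by rw [h2, add_sub_cancel_left]
  have h4 : (T₁ * R₁).map p = 0 := by
    rw [hT, Matrix.map_mul, Matrix.map_mul, hDp, Matrix.mul_zero, Matrix.zero_mul]
  have h5 : T₂ * R₂ = 1 := hp R₂ T₂ h22.symm (by
    rw [h3, Matrix.map_sub p (map_sub p), h4, sub_zero, Matrix.map_one p (map_zero p) (map_one p)])
  have h6 : T₁ * R₁ = 0 := by
    rw [h5] at h3
    exact sub_eq_self.1 h3.symm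
  calc D = R₁ * T₁ * (R₁ * T₁) := by rw [← h11, hD]
    _ = R₁ * (T₁ * R₁) * T₁ := by simp only [Matrix.mul_assoc]
    _ = 0 := by rw [h6, Matrix.mul_zero, Matrix.zero_mul]

/-- `v` is the class of the 1×1 matrix `e`, and `D` is diagonal with `n` entries `e`; it can vanish
only when it is the empty matrix. -/
theorem IdemMat.exists_nsmul {C : Type*} [Ring C] (p : A →+* C) {e : A} (he : e * e = e)
    (he0 : e ≠ 0) (hep : p e = 0) :
    ∃ v : VMonoid A, ∀ n : ℕ, ∃ D : IdemMat A, D.toV = n • v ∧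
      D.mat.map p = 0 ∧ (D.mat = 0 → n = 0) := by
  let E : IdemMat A := ⟨1, Matrix.of fun _ _ => e, by ext; simp [Matrix.mul_apply, he]⟩
  refine ⟨E.toV, fun n => ?_⟩
  induction n with
  | zero => exact ⟨⟨0, 0, by simp⟩, (zero_nsmul E.toV).symm, by ext i; exact i.elim0, fun _ => rfl⟩
  | succ n ih =>
    obtain ⟨D, hD, hDp, -⟩ := ih
    refine ⟨D.sum E, ?_, ?_, fun h => ?_⟩
    · rw [succ_nsmul, ← hD, IdemMat.toV_sum]
    · ext i j
      obtain ⟨i, rfl⟩ := finSumFinEquiv.surjective i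
      obtain ⟨j, rfl⟩ := finSumFinEquiv.surjective j
      rcases i with i | i <;> rcases j with j | j <;>
        simp only [IdemMat.sum, blockDiag, E, hep, Matrix.map_apply, Matrix.submatrix_apply,
          Equiv.symm_apply_apply, Matrix.fromBlocks_apply₁₁, Matrix.fromBlocks_apply₁₂,
          Matrix.fromBlocks_apply₂₁, Matrix.fromBlocks_apply₂₂, Matrix.zero_apply, map_zero,
          Matrix.of_apply]
      · exact congrFun (congrFun hDp i) j
      all_goals rfl
    · have := congrFun (congrFun h (finSumFinEquiv (Sum.inr 0))) (finSumFinEquiv (Sum.inr 0))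
      simp [IdemMat.sum, blockDiag, E] at this
      exact absurd this he0

/-- `K₀(A)` contains a copy of `ℤ` when some ideal contains a nonzero idempotent and one-sided
inverses of matrices that are two-sided modulo the ideal are two-sided. -/
theorem exists_int_injective_of_idempotent {C : Type*} [Ring C] (p : A →+* C)
    (hp : ∀ (k : ℕ) (a b : Matrix (Fin k) (Fin k) A), a * b = 1 → (b * a).map p = 1 → b * a = 1)
    {e : A} (he : e * e = e) (he0 : e ≠ 0) (hep : p e = 0) :
    ∃ f : ℤ →+ KZero A, Function.Injective f := by
  obtain ⟨v, hv⟩ := IdemMat.exists_nsmul p he he0 hep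
  refine ⟨zmultiplesHom _ (Algebra.GrothendieckAddGroup.of v),
    injective_zsmul_iff_not_isOfFinAddOrder.2 fun hfin => ?_⟩
  obtain ⟨n, hn, hn0⟩ := isOfFinAddOrder_iff_nsmul_eq_zero.1 hfin
  obtain ⟨D, hD, hDp, hD0⟩ := hv n
  rw [← map_nsmul, ← hD, ← map_zero (Algebra.GrothendieckAddGroup.of (M := VMonoid A))] at hn0
  -- V(A) need not be cancellative: vanishing in K₀ only gives equality after adding some `c`.
  obtain ⟨c, hc⟩ := (AddLocalization.addMonoidOf (⊤ : AddSubmonoid (VMonoid A))).eq_iff_exists.1 hn0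
  rw [add_zero, add_comm] at hc
  obtain ⟨k, hk⟩ := exists_blockDiag_one_matEquiv hc
  exact hn.ne' (hD0 (eq_zero_of_blockDiag_one_matEquiv p (hp k) D.idem hDp hk))

variable {X : Type u} [NormedAddCommGroup X] [NormedSpace ℂ X] [CompleteSpace X]
  [InfiniteDimensional X] {J : OperatorIdeal.{u}}

theorem OperatorIdeal.exists_int_injective_of_splits (hnonzero : J.NonZero)
    (hsing : J.InStrictlySingular) (hsplit : (J.sequence X).SplitsAlgebraically) :
    ∃ f : ℤ →+ KZero (X →L[ℂ] X), Function.Injective f := by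
  have : Nontrivial X := by
    by_contra h
    rw [not_nontrivial_iff_subsingleton] at h
    exact InfiniteDimensional.not_finiteDimensional (X := X) inferInstance
  obtain ⟨x, hx⟩ := exists_ne (0 : X)
  obtain ⟨f, hf⟩ := SeparatingDual.exists_eq_one (R := ℂ) hx
  refine exists_int_injective_of_idempotent (Ideal.Quotient.mk (J.ideal X))
    -- As `f x = 1`, this is a rank-one projection, and it lies in the ideal.
    (fun k a b hab hba => J.mul_eq_one_of_splits hsing hsplit hab hba) (e := f.smulRight x)
    ?_ (fun h => hx ?_) (Ideal.Quotient.eq_zero_iff_mem.2 (J.smulRight_mem hnonzero f x))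
  · ext y
    simp [hf]
  · simpa [hf] using DFunLike.congr_fun h x

end KZero

end BanachKTheory

theorem corollary4p3 (J : OperatorIdeal.{u}) (hclosed : J.Closed) (hnonzero : J.NonZero)
    (hsing : J.InStrictlySingular)
    (X : Type u) [NormedAddCommGroup X] [NormedSpace ℂ X] [CompleteSpace X]
    [InfiniteDimensional X] :
    -- part (i)
    ((J.sequence X).SplitsAlgebraically →
      ∃ H : AddSubgroup (KZero (X →L[ℂ] X)), Nonempty (ℤ ≃+ H)) ∧
    (Subsingleton (KZero (X →L[ℂ] X)) → ¬ (J.sequence X).SplitsAlgebraically) ∧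
    -- part (ii); `Fin m → X` with its maximum norm is the direct sum of `m` copies of `X`
    (∀ m : ℕ, IsoToProperFiniteCodim (Fin m → X) ↔
      ∃ T : (Fin m → X) →L[ℂ] (Fin m → X), T.IsFredholm ∧ fredholmIndex T ≠ 0) ∧
    ((∃ m : ℕ, IsoToProperFiniteCodim (Fin m → X)) → ¬ (J.sequence X).SplitsAlgebraically) := by
  refine ⟨fun hsplit => ?_, fun _ hsplit => ?_, fun m => isoToProperFiniteCodim_iff,
    fun ⟨m, hm⟩ hsplit => J.not_isoToProperFiniteCodim_of_splits hnonzero hsing hsplit hm⟩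
  · obtain ⟨f, hf⟩ := J.exists_int_injective_of_splits hnonzero hsing hsplit
    exact ⟨f.range, ⟨f.ofInjective hf⟩⟩
  · obtain ⟨f, hf⟩ := J.exists_int_injective_of_splits hnonzero hsing hsplit
    exact zero_ne_one (hf (Subsingleton.elim (f 0) (f 1)))
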